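/- Let $\mathcal N=\{1,\dots,n\}$ be a finite set of products and $\mathcal S$ a collection of assortments $S\subseteq\mathcal N$, let $\mathcal I_{\mathcal S}=\{(i,S): S\in\mathcal S,\ i\in S\}$, and let $\boldsymbol p_{\mathcal S}=(p_{i,S})_{(i,S)\in\mathcal I_{\mathcal S}}$ be choice data, i.e. $\boldsymbol p_S=(p_{i,S})_{i\in S}$ lies in the probability simplex $\Delta_S=\{x\in\mathbb R^S: x_i\ge 0,\ \sum_{i\in S}x_i=1\}$ for every $S\in\mathcal S$. A marginal distribution model (MDM) is given by deterministic utilities $\nu_1,\dots,\nu_n\in\mathbb R$ and marginal distributions $F_1,\dots,F_n$ of random terms $\tilde\epsilon_1,\dots,\tilde\epsilon_n$, where each $F_i$ is absolutely continuous, strictly increasing on its support, and satisfies $\mathbb E|\tilde\epsilon_i|<\infty$. Let $\Theta$ be the set of joint distributions of $(\tilde\epsilon_1,\dots,\tilde\epsilon_n)$ with marginals $F_1,\dots,F_n$. The choice probability of $i\in S$ is the probability that $i=\arg\max_{j\in S}(\nu_j+\tilde\epsilon_j)$ under a $\theta^*\in\Theta$ that maximizes $\mathbb E_\theta[\max_{j\in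 S}(\nu_j+\tilde\epsilon_j)]$ over $\theta\in\Theta$. Let $\mathcal P_{\mathrm{MDM}}(\mathcal S)\subseteq\mathbb R^{\mathcal I_{\mathcal S}}$ be the set of all $\boldsymbol x_{\mathcal S}=(x_{i,S})$ for which some MDM (the same for all $S\in\mathcal S$) has choice probabilities $x_{i,S}$ for all $(i,S)\in\mathcal I_{\mathcal S}$. Let $\mathrm{loss}(\boldsymbol p_{\mathcal S},\boldsymbol x_{\mathcal S})=\sum_{S\in\mathcal S}\mathrm{loss}_S(\boldsymbol p_S,\boldsymbol x_S)$, where each $\boldsymbol x_S\mapsto\mathrm{loss}_S(\boldsymbol p_S,\boldsymbol x_S)\in[0,\infty]$ is continuous on $\Delta_S$, and define the limit of MDM by $\mathcal L(\boldsymbol p_{\mathcal S})=\inf\{\mathrm{loss}(\boldsymbol p_{\mathcal S},\boldsymbol x_{\mathcal S}):\boldsymbol x_{\mathcal S}\in\mathcal P_{\mathrm{MDM}}(\mathcal S)\}$. Consider the following constraints on $\boldsymbol x_{\mathcal S}\in\mathbb R^{\mathcal I_{\mathcal S}}$ and $\boldsymbol\lambda\in\mathbb R^{\mathcal S}$: $$x_{i,S}\ge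 x_{i,T}\ \text{ if }\ \lambda_S\le\lambda_T\quad\forall (i,S),(i,T)\in\mathcal I_{\mathcal S},\qquad \sum_{i\in S}x_{i,S}=1\quad\forall S\in\mathcal S,\qquad x_{i,S}\ge 0\quad\forall (i,S)\in\mathcal I_{\mathcal S}.\tag{$*$}$$ Then the closure of $\mathcal P_{\mathrm{MDM}}(\mathcal S)$ is the set of all $\boldsymbol x_{\mathcal S}$ for which some $\boldsymbol\lambda$ satisfies $(*)$, and $$\mathcal L(\boldsymbol p_{\mathcal S})=\min_{\boldsymbol x_{\mathcal S},\,\boldsymbol\lambda}\Big\{\sum_{S\in\mathcal S}\mathrm{loss}_S(\boldsymbol p_S,\boldsymbol x_S)\ :\ (\boldsymbol x_{\mathcal S},\boldsymbol\lambda)\text{ satisfies }(*)\Big\},$$ where the minimum is attained. -/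

import Mathlib

open MeasureTheory
open scoped ENNReal

noncomputable section

namespace MDM

/-- The regularity required of the marginal law `μ` of each random term: it is an absolutely
continuous probability law on the line with finite first absolute moment, and its distribution
function is strictly increasing on its support. -/
structure RegularMarginal (μ : Measure ℝ) : Prop where
  isProbabilityMeasure : IsProbabilityMeasure μ
  absolutelyContinuous : μ ≪ volume
  strictMonoOn_cdf : StrictMonoOn (ProbabilityTheory.cdf μ) μ.support
  integrable : Integrable (fun t : ℝ => t) μ

/-- The joint laws of `(ε₁, …, εₙ)` with prescribed marginals `F₁, …, Fₙ`. -/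
def jointLaws {n : ℕ} (F : Fin n → Measure ℝ) : Set (Measure (Fin n → ℝ)) :=
  {θ | IsProbabilityMeasure θ ∧ ∀ i, θ.map (fun ε => ε i) = F i}

/-- The expected maximal utility `E_θ [max_{i ∈ S} (ν i + ε i)]` offered by the assortment `S`. -/
def expectedMax {n : ℕ} (ν : Fin n → ℝ) (S : Finset (Fin n)) (θ : Measure (Fin n → ℝ)) : ℝ :=
  ∫ ε, (⨆ i : {i // i ∈ S}, (ν i + ε i)) ∂θ

/-- The probability under `θ` that product `i` is the utility maximizer in `S`. -/
def choiceProb {n : ℕ} (ν : Fin n → ℝ) (S : Finset (Fin n)) (θ : Measure (Fin n → ℝ))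
    (i : Fin n) : ℝ :=
  θ.real {ε | ∀ j ∈ S, j ≠ i → ν j + ε j < ν i + ε i}

/-- Families `(x_{i,S} : i ∈ S, S ∈ 𝒮)` of reals indexed by the product-assortment pairs of an
assortment collection `𝒮`, with the product topology. -/
abbrev Collection {n : ℕ} (𝒮 : Finset (Finset (Fin n))) : Type :=
  ∀ S : {S // S ∈ 𝒮}, {i // i ∈ S.1} → ℝ

/-- The collections that are representable by a marginal distribution model: a single choice of
marginals and deterministic utilities yields, for every assortment, the given numbers as choice
probabilities under a joint law that maximizes the expected maximal utility. -/
def representable {n : ℕ} (𝒮 : Finset (Finset (Fin n))) : Set (Collection 𝒮) :=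
  {x | ∃ (F : Fin n → Measure ℝ) (ν : Fin n → ℝ),
    (∀ i, RegularMarginal (F i)) ∧
    ∀ S : {S // S ∈ 𝒮}, ∃ θ ∈ jointLaws F, IsMaxOn (expectedMax ν S.1) (jointLaws F) θ ∧
      ∀ i : {i // i ∈ S.1}, x S i = choiceProb ν S.1 θ i}

/-- The loss of a collection `x` with respect to the data `p`, summed over the assortments. -/
def totalLoss {n : ℕ} {𝒮 : Finset (Finset (Fin n))}
    (loss : ∀ S : {S // S ∈ 𝒮}, ({i // i ∈ S.1} → ℝ) → ({i // i ∈ S.1} → ℝ) → ℝ≥0∞)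
    (p x : Collection 𝒮) : ℝ≥0∞ :=
  ∑ S, loss S (p S) (x S)

/-- The limit of MDM: the infimum of the loss over the representable collections. -/
def limitMDM {n : ℕ} {𝒮 : Finset (Finset (Fin n))}
    (loss : ∀ S : {S // S ∈ 𝒮}, ({i // i ∈ S.1} → ℝ) → ({i // i ∈ S.1} → ℝ) → ℝ≥0∞)
    (p : Collection 𝒮) : ℝ≥0∞ :=
  ⨅ x ∈ representable 𝒮, totalLoss loss p x

/-- The constraints on `(x, lam)`: order constraints and simplex constraints. -/
structure Feasible {n : ℕ} {𝒮 : Finset (Finset (Fin n))} (x : Collection 𝒮)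
    (lam : {S // S ∈ 𝒮} → ℝ) : Prop where
  order : ∀ (S T : {S // S ∈ 𝒮}) (i : Fin n) (hS : i ∈ S.1) (hT : i ∈ T.1),
    lam S ≤ lam T → x S ⟨i, hS⟩ ≥ x T ⟨i, hT⟩
  sum_eq_one : ∀ S, ∑ i, x S i = 1
  nonneg : ∀ S i, 0 ≤ x S i

end MDM

end

/-! For every level `lam`, the maximal utility is at most `lam` plus the sum of the excesses over
`lam`. The expectation of this bound depends only on the marginals, so it bounds the expected
maximum over all couplings. Equality holds when exactly one utility exceeds `lam` almost surely, and
a coupling with this property exists as soon as the tails `F i (lam - ν i, ∞)` sum to one over the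
assortment (`exists_jointLaw_existsUnique`). Since the marginals have no atoms, every optimal
coupling then has these tails as choice probabilities (`choiceProb_eq`). Tails decrease in the
level, so the levels of the assortments serve as `lam` in the order constraints.

Conversely, only the ranks of the levels matter. A feasible `x` gives, for each product, an antitone
function of the rank, which is the tail function of a law with piecewise constant density. A small
Gaussian admixture makes this law regular; the levels are then solved anew, and monotonicity of the
tails keeps the choice probabilities close to `x` (`Feasible.mem_closure_representable`).

The feasible set is a finite union of closed sets, one per rank assignment, inside a product of
simplices. It is therefore compact, and continuity of the loss gives both the attained minimum and
its equality with the infimum over the dense representable subset. -/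

namespace MDM

/-! ### Coupling of disjoint events and the pointwise dual bound -/

/-- If the probabilities of the events `ε i ∈ A i` sum to one, then some coupling of the marginals
makes exactly one of these events occur almost surely. -/
theorem exists_jointLaw_existsUnique {n : ℕ} (F : Fin n → Measure ℝ)
    [∀ i, IsProbabilityMeasure (F i)] (A : Fin n → Set ℝ) (hA : ∀ i, MeasurableSet (A i))
    (hsum : ∑ i, F i (A i) = 1) :
    ∃ θ ∈ jointLaws F, ∀ᵐ ε ∂θ, ∃! i, ε i ∈ A i := by
  classical
  -- Given that `i` is the selected index, coordinate `i` is conditioned on `A i` and every other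
  -- coordinate `j` on the complement of `A j`, independently. The coupling mixes these product laws
  -- with weights `F i (A i)`.
  let Q : Fin n → Fin n → Measure ℝ := fun i j =>
    if j = i then ProbabilityTheory.cond (F j) (A j) else ProbabilityTheory.cond (F j) (A j)ᶜ
  have hQ : ∀ i, F i (A i) ≠ 0 → ∀ j, IsProbabilityMeasure (Q i j) := by
    intro i hi j
    by_cases hji : j = i
    · subst hji
      simp only [Q, if_true]
      exact ProbabilityTheory.cond_isProbabilityMeasure hi
    · simp only [Q, if_neg hji]
      refine ProbabilityTheory.cond_isProbabilityMeasure fun h0 => hi ?_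
      have h1 : F j (A j) = 1 := by
        rw [prob_compl_eq_zero_iff (hA j)] at h0
        exact h0
      rw [← Finset.add_sum_erase _ _ (Finset.mem_univ j), h1] at hsum
      have h2 : ∑ k ∈ Finset.univ.erase j, F k (A k) = 0 := by
        have := ENNReal.add_right_inj (a := 1) (b := ∑ k ∈ Finset.univ.erase j, F k (A k)) (c := 0)
          (by simp)
        simpa using this.1 (by simpa using hsum)
      exact Finset.sum_eq_zero_iff.1 h2 i (by simp [Ne.symm hji])
  -- The total weight of the components with `i ≠ j` is the probability of the complement of `A j`,
  -- so marginal `j` is recovered by the law of total probability.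
  have hcompl : ∀ j, ∑ i ∈ Finset.univ.erase j, F i (A i) = F j (A j)ᶜ := by
    intro j
    rw [prob_compl_eq_one_sub (hA j), ← hsum, ← Finset.add_sum_erase _ _ (Finset.mem_univ j),
      ENNReal.add_sub_cancel_left (measure_ne_top _ _)]
  refine ⟨∑ i, F i (A i) • Measure.pi (Q i), ⟨⟨?_⟩, fun j => ?_⟩, ?_⟩
  · rw [Measure.finsetSum_apply, ← hsum]
    refine Finset.sum_congr rfl fun i _ => ?_
    by_cases hi : F i (A i) = 0
    · simp [hi]
    · have := hQ i hi
      simp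
  · ext s hs
    rw [Measure.map_apply (measurable_pi_apply j) hs, Measure.finsetSum_apply]
    have hterm : ∀ i, (F i (A i) • Measure.pi (Q i)) ((fun ε : Fin n → ℝ => ε j) ⁻¹' s)
        = F i (A i) * Q i j s := by
      intro i
      by_cases hi : F i (A i) = 0
      · simp [hi]
      · have := hQ i hi
        rw [Measure.smul_apply, smul_eq_mul,
          (measurePreserving_eval (Q i) j).measure_preimage hs.nullMeasurableSet]
    rw [Finset.sum_congr rfl fun i _ => hterm i, ← Finset.add_sum_erase _ _ (Finset.mem_univ j)]
    have hne : ∀ i ∈ Finset.univ.erase j, F i (A i) * Q i j s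
        = F i (A i) * ProbabilityTheory.cond (F j) (A j)ᶜ s := by
      intro i hi
      simp only [Q, if_neg (Finset.ne_of_mem_erase hi).symm]
    rw [Finset.sum_congr rfl hne, ← Finset.sum_mul, hcompl j]
    simp only [Q, if_true]
    rw [mul_comm, ProbabilityTheory.cond_mul_eq_inter (hA j), mul_comm,
      ProbabilityTheory.cond_mul_eq_inter (hA j).compl, Set.inter_comm, Set.inter_comm (A j)ᶜ]
    exact measure_inter_add_sdiff s (hA j)
  · rw [ae_iff, Measure.finsetSum_apply]
    refine Finset.sum_eq_zero fun i _ => ?_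
    by_cases hi : F i (A i) = 0
    · simp [hi]
    · have := hQ i hi
      rw [Measure.smul_apply, smul_eq_mul]
      refine mul_eq_zero_of_right _ ?_
      rw [← ae_iff]
      have hj : ∀ j, ∀ᵐ ε ∂(Measure.pi (Q i)), ε j ∈ A j ↔ j = i := by
        intro j
        refine (measurePreserving_eval (Q i) j).quasiMeasurePreserving.ae
          (p := fun t => t ∈ A j ↔ j = i) ?_
        by_cases hji : j = i
        · simp only [Q, iff_true, hji]
          exact ProbabilityTheory.ae_cond_mem (hA i)
        · simp only [Q, if_neg hji, iff_false, hji]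
          exact ProbabilityTheory.ae_cond_mem (hA j).compl
      filter_upwards [ae_all_iff.2 hj] with ε hε
      exact ⟨i, (hε i).2 rfl, fun j h => (hε j).1 h⟩

/-- The maximum of finitely many reals is at most `lam` plus the sum of the excesses over `lam`. -/
theorem ciSup_le_add_sum_posPart {ι : Type*} [Fintype ι] [Nonempty ι] (u : ι → ℝ) (lam : ℝ) :
    ⨆ i, u i ≤ lam + ∑ i, max (u i - lam) 0 := by
  refine ciSup_le fun i => ?_
  have h1 := Finset.single_le_sum (f := fun j => max (u j - lam) 0)
    (fun j _ => le_max_right _ _) (Finset.mem_univ i)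
  have h2 := le_max_left (u i - lam) 0
  linarith

theorem ciSup_eq_add_sum_posPart {ι : Type*} [Fintype ι] [Nonempty ι] {u : ι → ℝ} {lam : ℝ}
    (h : ∃! i, lam < u i) : ⨆ i, u i = lam + ∑ i, max (u i - lam) 0 := by
  obtain ⟨i, hi, huniq⟩ := h
  refine le_antisymm (ciSup_le_add_sum_posPart u lam) ?_
  rw [Finset.sum_eq_single i]
  · rw [max_eq_left (by linarith)]
    have := le_ciSup (Set.finite_range u).bddAbove i
    linarith
  · intro j _ hj
    exact max_eq_right (by linarith [not_lt.1 fun h' => hj (huniq j h')])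
  · simp

/-- If no utility exceeded `lam`, the maximum would equal `lam`, which the absence of ties excludes;
if two did, the second positive part would make the bound strict. -/
theorem existsUnique_lt_of_ciSup_eq {ι : Type*} [Fintype ι] [Nonempty ι] {u : ι → ℝ} {lam : ℝ}
    (h : ⨆ i, u i = lam + ∑ i, max (u i - lam) 0) (hne : ∀ i, u i ≠ lam) : ∃! i, lam < u i := by
  classical
  obtain ⟨i, hi⟩ := exists_eq_ciSup_of_finite (f := u)
  have hle : ∀ j, u j ≤ u i := fun j => hi ▸ le_ciSup (Set.finite_range u).bddAbove j
  have hlt : lam < u i := by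
    by_contra hcon
    rw [Finset.sum_eq_zero fun j _ =>
      max_eq_right (by linarith [hle j, not_lt.1 hcon] : u j - lam ≤ 0)] at h
    exact hne i (by rw [hi, h, add_zero])
  refine ⟨i, hlt, fun j hj => ?_⟩
  by_contra hji
  have h1 := Finset.add_le_sum (f := fun k => max (u k - lam) 0) (s := Finset.univ)
    (fun k _ => le_max_right _ _) (Finset.mem_univ i) (Finset.mem_univ j) (Ne.symm hji)
  have h2 := le_max_left (u i - lam) 0
  have h3 := le_max_left (u j - lam) 0
  linarith

/-! ### Optimal couplings and their choice probabilities -/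

section Optimal

variable {n : ℕ} {F : Fin n → Measure ℝ} {θ : Measure (Fin n → ℝ)}

theorem integrable_eval (hF : ∀ i, RegularMarginal (F i)) (hθ : θ ∈ jointLaws F) (i : Fin n) :
    Integrable (fun ε : Fin n → ℝ => ε i) θ := by
  have h := (hF i).integrable
  rw [← hθ.2 i] at h
  have hm : Measurable (fun ε : Fin n → ℝ => ε i) := measurable_pi_apply i
  exact h.comp_measurable hm

theorem integrable_ciSup (hF : ∀ i, RegularMarginal (F i)) (hθ : θ ∈ jointLaws F)
    (ν : Fin n → ℝ) {S : Finset (Fin n)} (hS : S.Nonempty) :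
    Integrable (fun ε : Fin n → ℝ => ⨆ i : {i // i ∈ S}, (ν i + ε i)) θ := by
  have := hθ.1
  have : Nonempty {i // i ∈ S} := hS.to_subtype
  have hi : ∀ i : {i // i ∈ S}, Integrable (fun ε : Fin n → ℝ => ν i + ε i) θ :=
    fun i => (integrable_const _).add (integrable_eval hF hθ i)
  refine Integrable.mono' (g := fun ε => ∑ i : {i // i ∈ S}, |ν i + ε i|)
    (integrable_finsetSum _ fun i _ => (hi i).abs) ?_ ?_
  · refine (Measurable.iSup fun i => ?_).aestronglyMeasurable
    exact measurable_const.add (measurable_pi_apply _)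
  · refine ae_of_all _ fun ε => ?_
    obtain ⟨i, h⟩ := exists_eq_ciSup_of_finite (f := fun i : {i // i ∈ S} => ν i + ε i)
    rw [← h, Real.norm_eq_abs]
    exact Finset.single_le_sum (f := fun i : {i // i ∈ S} => |ν i + ε i|)
      (fun j _ => abs_nonneg _) (Finset.mem_univ i)

theorem integrable_dual (hF : ∀ i, RegularMarginal (F i)) (hθ : θ ∈ jointLaws F)
    (ν : Fin n → ℝ) (S : Finset (Fin n)) (lam : ℝ) :
    Integrable (fun ε : Fin n → ℝ => lam + ∑ i : {i // i ∈ S}, max (ν i + ε i - lam) 0) θ := by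
  have := hθ.1
  refine (integrable_const _).add (integrable_finsetSum _ fun i _ => ?_)
  exact (((integrable_const _).add (integrable_eval hF hθ i)).sub (integrable_const _)).pos_part

/-- The integral of the dual bound depends on the marginals only. -/
theorem integral_dual (hF : ∀ i, RegularMarginal (F i)) (hθ : θ ∈ jointLaws F)
    (ν : Fin n → ℝ) (S : Finset (Fin n)) (lam : ℝ) :
    ∫ ε, (lam + ∑ i : {i // i ∈ S}, max (ν i + ε i - lam) 0) ∂θ
      = lam + ∑ i : {i // i ∈ S}, ∫ t, max (ν i + t - lam) 0 ∂(F i) := by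
  have := hθ.1
  have hint : ∀ i : {i // i ∈ S},
      Integrable (fun ε : Fin n → ℝ => max (ν i + ε i - lam) 0) θ := fun i =>
    (((integrable_const _).add (integrable_eval hF hθ i)).sub (integrable_const _)).pos_part
  rw [integral_add (integrable_const _) (integrable_finsetSum _ fun i _ => hint i),
    integral_finsetSum _ fun i _ => hint i]
  congr 1
  · simp
  · refine Finset.sum_congr rfl fun i _ => ?_
    rw [← hθ.2 i, integral_map (measurable_pi_apply _).aemeasurable]
    exact Continuous.aestronglyMeasurable (by fun_prop)

theorem expectedMax_le (hF : ∀ i, RegularMarginal (F i)) (hθ : θ ∈ jointLaws F)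
    (ν : Fin n → ℝ) {S : Finset (Fin n)} (hS : S.Nonempty) (lam : ℝ) :
    expectedMax ν S θ ≤ lam + ∑ i : {i // i ∈ S}, ∫ t, max (ν i + t - lam) 0 ∂(F i) := by
  have : Nonempty {i // i ∈ S} := hS.to_subtype
  rw [← integral_dual hF hθ]
  exact integral_mono (integrable_ciSup hF hθ ν hS) (integrable_dual hF hθ ν S lam)
    fun ε => ciSup_le_add_sum_posPart _ _

/-- If the tail probabilities at `lam` sum to one over `S`, the dual bound is attained. -/
theorem exists_expectedMax_eq (hF : ∀ i, RegularMarginal (F i))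
    (ν : Fin n → ℝ) {S : Finset (Fin n)} (hS : S.Nonempty) {lam : ℝ}
    (hlam : ∑ i ∈ S, (F i).real (Set.Ioi (lam - ν i)) = 1) :
    ∃ θ ∈ jointLaws F, expectedMax ν S θ
      = lam + ∑ i : {i // i ∈ S}, ∫ t, max (ν i + t - lam) 0 ∂(F i) := by
  classical
  have : ∀ i, IsProbabilityMeasure (F i) := fun i => (hF i).isProbabilityMeasure
  have : Nonempty {i // i ∈ S} := hS.to_subtype
  obtain ⟨θ, hθ, hu⟩ := exists_jointLaw_existsUnique F
    (fun i => if i ∈ S then Set.Ioi (lam - ν i) else ∅)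
    (fun i => by split_ifs <;> simp) (by
      rw [← ENNReal.toReal_eq_one_iff, ENNReal.toReal_sum fun i _ => measure_ne_top _ _, ← hlam,
        ← Finset.sum_subset (Finset.subset_univ S) fun i _ hi => by simp [hi]]
      exact Finset.sum_congr rfl fun i hi => by simp [hi, Measure.real])
  refine ⟨θ, hθ, ?_⟩
  rw [← integral_dual hF hθ]
  refine integral_congr_ae ?_
  filter_upwards [hu] with ε ⟨i, hi, huniq⟩
  have hiS : i ∈ S := by
    by_contra h
    simp [h] at hi
  refine ciSup_eq_add_sum_posPart ⟨⟨i, hiS⟩, ?_, fun j hj => Subtype.ext (huniq j ?_)⟩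
  · simp only [hiS, if_true, Set.mem_Ioi] at hi
    simp only
    linarith
  · simp only [j.2, if_true, Set.mem_Ioi]
    linarith

theorem isMaxOn_expectedMax_iff (hF : ∀ i, RegularMarginal (F i)) (hθ : θ ∈ jointLaws F)
    (ν : Fin n → ℝ) {S : Finset (Fin n)} (hS : S.Nonempty) {lam : ℝ}
    (hlam : ∑ i ∈ S, (F i).real (Set.Ioi (lam - ν i)) = 1) :
    IsMaxOn (expectedMax ν S) (jointLaws F) θ ↔ expectedMax ν S θ
      = lam + ∑ i : {i // i ∈ S}, ∫ t, max (ν i + t - lam) 0 ∂(F i) := by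
  constructor
  · intro h
    obtain ⟨θ', hθ', h'⟩ := exists_expectedMax_eq hF ν hS hlam
    exact le_antisymm (expectedMax_le hF hθ ν hS lam) (h' ▸ h hθ')
  · intro h θ' hθ'
    simp only [Set.mem_ofPred_eq, h]
    exact expectedMax_le hF hθ' ν hS lam

/-- At any optimal joint law the choice probabilities are the tail probabilities at `lam`. -/
theorem choiceProb_eq (hF : ∀ i, RegularMarginal (F i)) (hθ : θ ∈ jointLaws F)
    (ν : Fin n → ℝ) {S : Finset (Fin n)} {lam : ℝ}
    (hlam : ∑ i ∈ S, (F i).real (Set.Ioi (lam - ν i)) = 1)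
    (hmax : IsMaxOn (expectedMax ν S) (jointLaws F) θ) {i : Fin n} (hi : i ∈ S) :
    choiceProb ν S θ i = (F i).real (Set.Ioi (lam - ν i)) := by
  have hS : S.Nonempty := ⟨i, hi⟩
  have : Nonempty {i // i ∈ S} := hS.to_subtype
  rw [isMaxOn_expectedMax_iff hF hθ ν hS hlam, ← integral_dual hF hθ, expectedMax] at hmax
  -- Equal integrals turn the pointwise bound into an almost sure equality.
  have hae := (integral_eq_iff_of_ae_le (integrable_ciSup hF hθ ν hS)
    (integrable_dual hF hθ ν S lam)
    (ae_of_all _ fun ε => ciSup_le_add_sum_posPart _ _)).1 hmax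
  have hne : ∀ j, ∀ᵐ ε ∂θ, ν j + ε j ≠ lam := by
    intro j
    have h0 : ∀ᵐ t ∂(F j), ν j + t ≠ lam := by
      refine (hF j).absolutelyContinuous.ae_le ?_
      filter_upwards [Measure.ae_ne volume (lam - ν j)] with t ht h
      exact ht (by linarith)
    rw [← hθ.2 j] at h0
    exact ae_of_ae_map (measurable_pi_apply j).aemeasurable h0
  rw [← hθ.2 i, map_measureReal_apply (measurable_pi_apply i) measurableSet_Ioi, choiceProb]
  refine measureReal_congr ?_
  filter_upwards [hae, ae_all_iff.2 hne] with ε h1 h2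
  obtain ⟨k, hk, huniq⟩ := existsUnique_lt_of_ciSup_eq h1 fun j => h2 j
  refine propext ⟨fun h => ?_, fun h j hj hji => ?_⟩
  · show lam - ν i < ε i
    by_cases hki : (k : Fin n) = i
    · rw [← hki]
      linarith
    · have := h k k.2 hki
      linarith
  · have h' : lam - ν i < ε i := h
    have hik := huniq ⟨i, hi⟩ (by simp only; linarith)
    have hjk : ¬ lam < ν j + ε j := fun hj' =>
      hji (congrArg Subtype.val ((huniq ⟨j, hj⟩ hj').trans hik.symm))
    linarith

end Optimal

/-! ### Existence of a level at which the tails sum to one -/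

section Tails

open Filter Topology ProbabilityTheory

theorem continuous_cdf_of_nullSingletonClass (μ : Measure ℝ) [IsProbabilityMeasure μ] [NullSingletonClass μ] :
    Continuous (cdf μ) := by
  refine continuous_iff_continuousAt.2 fun a => ?_
  rw [(monotone_cdf μ).continuousAt_iff_leftLim_eq_rightLim, StieltjesFunction.rightLim_eq]
  refine le_antisymm ((monotone_cdf μ).leftLim_le le_rfl) ?_
  have h := (cdf μ).measure_singleton a
  rw [measure_cdf, measure_singleton] at h
  linarith [ENNReal.ofReal_eq_zero.1 h.symm]

theorem measureReal_Ioi_eq_one_sub_cdf (μ : Measure ℝ) [IsProbabilityMeasure μ] (t : ℝ) :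
    μ.real (Set.Ioi t) = 1 - cdf μ t := by
  rw [cdf_eq_real, ← Set.compl_Iic, probReal_compl_eq_one_sub measurableSet_Iic]

theorem RegularMarginal.nullSingletonClass {μ : Measure ℝ} (h : RegularMarginal μ) : NullSingletonClass μ :=
  ⟨fun _ => h.absolutelyContinuous (by simp)⟩

/-- With at least two alternatives some level makes the tail probabilities sum to one. -/
theorem exists_sum_tail_eq_one {n : ℕ} {F : Fin n → Measure ℝ}
    (hF : ∀ i, RegularMarginal (F i)) (ν : Fin n → ℝ) {S : Finset (Fin n)} (hS : 1 < S.card) :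
    ∃ lam : ℝ, ∑ i ∈ S, (F i).real (Set.Ioi (lam - ν i)) = 1 := by
  have : ∀ i, IsProbabilityMeasure (F i) := fun i => (hF i).isProbabilityMeasure
  have : ∀ i, NullSingletonClass (F i) := fun i => (hF i).nullSingletonClass
  have hcard : (1 : ℝ) < S.card := by exact_mod_cast hS
  simp only [measureReal_Ioi_eq_one_sub_cdf]
  have hcont : Continuous fun lam : ℝ => ∑ i ∈ S, (1 - cdf (F i) (lam - ν i)) :=
    continuous_finsetSum _ fun i _ => continuous_const.sub
      ((continuous_cdf_of_nullSingletonClass (F i)).comp (continuous_id.sub continuous_const))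
  have hbot : Tendsto (fun lam : ℝ => ∑ i ∈ S, (1 - cdf (F i) (lam - ν i))) atBot
      (𝓝 (∑ i ∈ S, (1 - 0))) :=
    tendsto_finsetSum _ fun i _ => tendsto_const_nhds.sub
      ((tendsto_cdf_atBot (F i)).comp (tendsto_atBot_add_const_right _ _ tendsto_id))
  have htop : Tendsto (fun lam : ℝ => ∑ i ∈ S, (1 - cdf (F i) (lam - ν i))) atTop
      (𝓝 (∑ i ∈ S, (1 - 1))) :=
    tendsto_finsetSum _ fun i _ => tendsto_const_nhds.sub
      ((tendsto_cdf_atTop (F i)).comp (tendsto_atTop_add_const_right _ _ tendsto_id))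
  -- Intermediate value theorem: the sum runs from `S.card > 1` down to `0`. For a singleton the
  -- value one need not be attained.
  exact mem_range_of_exists_le_of_exists_ge hcont
    (htop.eventually_le_const (by simp)).exists (hbot.eventually_const_le (by simpa)).exists

end Tails

/-! ### Representable collections in terms of tails -/

section Representable

variable {n : ℕ} {𝒮 : Finset (Finset (Fin n))}

theorem choiceProb_eq_one {F : Fin n → Measure ℝ} {θ : Measure (Fin n → ℝ)}
    (hθ : θ ∈ jointLaws F) (ν : Fin n → ℝ) {S : Finset (Fin n)} (hS : S.card ≤ 1) {i : Fin n}
    (hi : i ∈ S) : choiceProb ν S θ i = 1 := by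
  have := hθ.1
  have huniv : {ε : Fin n → ℝ | ∀ j ∈ S, j ≠ i → ν j + ε j < ν i + ε i} = Set.univ :=
    Set.eq_univ_of_forall fun ε j hj hji => absurd (Finset.card_le_one.1 hS j hj i hi) hji
  rw [choiceProb, huniv, probReal_univ]

/-- With a single alternative every coupling of the marginals is optimal. -/
theorem isMaxOn_expectedMax_of_card_eq_one {F : Fin n → Measure ℝ} (ν : Fin n → ℝ)
    {S : Finset (Fin n)} (hS : S.card = 1) {θ : Measure (Fin n → ℝ)} (hθ : θ ∈ jointLaws F) :
    IsMaxOn (expectedMax ν S) (jointLaws F) θ := by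
  obtain ⟨i, rfl⟩ := Finset.card_eq_one.1 hS
  have hval : ∀ θ' ∈ jointLaws F, expectedMax ν {i} θ' = ∫ t, (ν i + t) ∂(F i) := by
    intro θ' hθ'
    have hm : Measurable (fun ε : Fin n → ℝ => ε i) := measurable_pi_apply i
    rw [← hθ'.2 i, integral_map hm.aemeasurable
      (Continuous.aestronglyMeasurable (by fun_prop)), expectedMax]
    refine integral_congr_ae (ae_of_all _ fun ε => ?_)
    exact ciSup_unique (s := fun j : {j // j ∈ ({i} : Finset (Fin n))} => ν j + ε j)
  intro θ' hθ'
  exact (hval θ' hθ').le.trans (hval θ hθ).ge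

/-- The tail probabilities at levels where they sum to one form a representable collection. -/
theorem mem_representable_of_tail {F : Fin n → Measure ℝ} (hF : ∀ i, RegularMarginal (F i))
    (ν : Fin n → ℝ) (lam : {S // S ∈ 𝒮} → ℝ) {x : Collection 𝒮}
    (hx : ∀ S, (S.1.card = 1 ∧ ∀ i, x S i = 1) ∨
      (S.1.Nonempty ∧ ∑ i ∈ S.1, (F i).real (Set.Ioi (lam S - ν i)) = 1 ∧
        ∀ i, x S i = (F i).real (Set.Ioi (lam S - ν i)))) :
    x ∈ representable 𝒮 := by
  have : ∀ i, IsProbabilityMeasure (F i) := fun i => (hF i).isProbabilityMeasure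
  refine ⟨F, ν, hF, fun S => ?_⟩
  rcases hx S with ⟨hS, h1⟩ | ⟨hS, hlam, h1⟩
  · have hθ : Measure.pi F ∈ jointLaws F :=
      ⟨inferInstance, fun i => (measurePreserving_eval F i).map_eq⟩
    exact ⟨_, hθ, isMaxOn_expectedMax_of_card_eq_one ν hS hθ,
      fun i => (h1 i).trans (choiceProb_eq_one hθ ν hS.le i.2).symm⟩
  · obtain ⟨θ, hθ, h⟩ := exists_expectedMax_eq hF ν hS hlam
    have hmax := (isMaxOn_expectedMax_iff hF hθ ν hS hlam).2 h
    exact ⟨θ, hθ, hmax, fun i => (h1 i).trans (choiceProb_eq hF hθ ν hlam hmax i.2).symm⟩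

theorem exists_feasible_of_mem_representable (hne : ∀ S ∈ 𝒮, S.Nonempty) {x : Collection 𝒮}
    (hx : x ∈ representable 𝒮) : ∃ lam, Feasible x lam := by
  classical
  obtain ⟨F, ν, hF, hrep⟩ := hx
  choose θ hθ hmax hxθ using hrep
  have : ∀ i, IsProbabilityMeasure (F i) := fun i => (hF i).isProbabilityMeasure
  have : ∀ S, IsProbabilityMeasure (θ S) := fun S => (hθ S).1
  have hlev : ∀ S : {S // S ∈ 𝒮}, ∃ lam : ℝ, 1 < S.1.card →
      ∑ i ∈ S.1, (F i).real (Set.Ioi (lam - ν i)) = 1 := by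
    intro S
    by_cases hS : 1 < S.1.card
    · obtain ⟨lam, h⟩ := exists_sum_tail_eq_one hF ν hS
      exact ⟨lam, fun _ => h⟩
    · exact ⟨0, fun h => absurd h hS⟩
  choose lev hlev using hlev
  -- Singletons have choice probability one, so they are placed at `m - 1`, strictly below all other
  -- levels.
  obtain ⟨m, hm⟩ := (Set.finite_range lev).bddBelow
  have hm : ∀ S, m ≤ lev S := fun S => hm ⟨S, rfl⟩
  have hbig : ∀ S : {S // S ∈ 𝒮}, 1 < S.1.card → ∀ i,
      x S i = (F i).real (Set.Ioi (lev S - ν i)) := fun S hS i =>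
    (hxθ S i).trans (choiceProb_eq hF (hθ S) ν (hlev S hS) (hmax S) i.2)
  have hsmall : ∀ S : {S // S ∈ 𝒮}, ¬ 1 < S.1.card → ∀ i, x S i = 1 := fun S hS i =>
    (hxθ S i).trans (choiceProb_eq_one (hθ S) ν (not_lt.1 hS) i.2)
  refine ⟨fun S => if 1 < S.1.card then lev S else m - 1, fun S T i hiS hiT hle => ?_,
    fun S => ?_, fun S i => ?_⟩
  · by_cases hS : 1 < S.1.card
    · by_cases hT : 1 < T.1.card
      · simp only [hS, hT, if_true] at hle
        rw [hbig S hS, hbig T hT]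
        exact measureReal_mono (Set.Ioi_subset_Ioi (by linarith))
      · simp only [hS, hT, if_true, if_false] at hle
        linarith [hm S]
    · rw [hsmall S hS, hxθ T]
      exact measureReal_le_one
  · by_cases hS : 1 < S.1.card
    · rw [Finset.sum_congr rfl fun i _ => hbig S hS i, ← hlev S hS]
      exact Finset.sum_coe_sort S.1 fun i => (F i).real (Set.Ioi (lev S - ν i))
    · rw [Finset.sum_congr rfl fun i _ => hsmall S hS i]
      have hcard : S.1.card = 1 :=
        le_antisymm (not_lt.1 hS) (Finset.card_pos.2 (hne S.1 S.2))
      simp [hcard]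
  · rw [hxθ S i]
    exact measureReal_nonneg

end Representable

/-! ### Compactness of the feasible set -/

section Feasible

variable {n : ℕ} {𝒮 : Finset (Finset (Fin n))}

/-- Only the order of the levels matters, so they may be taken to be ranks. -/
theorem Feasible.exists_rank {x : Collection 𝒮} {lam : {S // S ∈ 𝒮} → ℝ} (h : Feasible x lam) :
    ∃ r : {S // S ∈ 𝒮} → Fin (Fintype.card {S // S ∈ 𝒮} + 1),
      Feasible x fun S => ((r S : ℕ) : ℝ) := by
  classical
  -- The rank of `S` is the number of assortments at a strictly lower level.
  refine ⟨fun S => ⟨(Finset.univ.filter fun T => lam T < lam S).card,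
    Nat.lt_succ_of_le (Finset.card_le_univ _)⟩, fun S T i hS hT hle => ?_, h.2, h.3⟩
  refine h.order S T i hS hT (not_lt.1 fun hlt => ?_)
  refine absurd hle (not_le.2 (Nat.cast_lt.2 (Finset.card_lt_card ?_)))
  refine Finset.ssubset_iff_of_subset (fun U => ?_) |>.2 ⟨T, ?_, ?_⟩
  · simp only [Finset.mem_filter_univ]
    exact fun hU => hU.trans hlt
  · simpa using hlt
  · simp

theorem isClosed_setOf_feasible (lam : {S // S ∈ 𝒮} → ℝ) :
    IsClosed {x : Collection 𝒮 | Feasible x lam} := by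
  have heq : {x : Collection 𝒮 | Feasible x lam} =
      {x | ∀ (S T : {S // S ∈ 𝒮}) (i : Fin n) (hS : i ∈ S.1) (hT : i ∈ T.1),
        lam S ≤ lam T → x T ⟨i, hT⟩ ≤ x S ⟨i, hS⟩} ∩
      ({x | ∀ S, ∑ i, x S i = 1} ∩ {x | ∀ S i, 0 ≤ x S i}) := by
    ext x
    exact ⟨fun h => ⟨h.1, h.2, h.3⟩, fun h => ⟨h.1, h.2.1, h.2.2⟩⟩
  rw [heq]
  refine IsClosed.inter ?_ (IsClosed.inter ?_ ?_)
  · simp only [Set.ofPred_forall]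
    exact isClosed_iInter fun S => isClosed_iInter fun T => isClosed_iInter fun i =>
      isClosed_iInter fun hS => isClosed_iInter fun hT => isClosed_iInter fun _ =>
        isClosed_le (by fun_prop) (by fun_prop)
  · simp only [Set.ofPred_forall]
    exact isClosed_iInter fun S => isClosed_eq (by fun_prop) continuous_const
  · simp only [Set.ofPred_forall]
    exact isClosed_iInter fun S => isClosed_iInter fun i =>
      isClosed_le continuous_const (by fun_prop)

theorem isClosed_setOf_exists_feasible :
    IsClosed {x : Collection 𝒮 | ∃ lam, Feasible x lam} := by
  have heq : {x : Collection 𝒮 | ∃ lam, Feasible x lam} =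
      ⋃ r : {S // S ∈ 𝒮} → Fin (Fintype.card {S // S ∈ 𝒮} + 1),
        {x | Feasible x fun S => ((r S : ℕ) : ℝ)} := by
    ext x
    simp only [Set.mem_iUnion]
    exact ⟨fun ⟨lam, h⟩ => h.exists_rank, fun ⟨r, h⟩ => ⟨_, h⟩⟩
  rw [heq]
  exact isClosed_iUnion_of_finite fun r => isClosed_setOf_feasible _

theorem Feasible.mem_stdSimplex {x : Collection 𝒮} {lam : {S // S ∈ 𝒮} → ℝ}
    (h : Feasible x lam) (S : {S // S ∈ 𝒮}) : x S ∈ stdSimplex ℝ {i // i ∈ S.1} :=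
  ⟨h.nonneg S, h.sum_eq_one S⟩

theorem isCompact_setOf_exists_feasible :
    IsCompact {x : Collection 𝒮 | ∃ lam, Feasible x lam} :=
  (isCompact_univ_pi fun S : {S // S ∈ 𝒮} =>
    isCompact_stdSimplex ℝ {i // i ∈ S.1}).of_isClosed_subset isClosed_setOf_exists_feasible
      fun _ ⟨_, h⟩ S _ => h.mem_stdSimplex S

theorem exists_feasible (hne : ∀ S ∈ 𝒮, S.Nonempty) :
    ∃ (x : Collection 𝒮) (lam : {S // S ∈ 𝒮} → ℝ), Feasible x lam := by
  have hpos : ∀ S : {S // S ∈ 𝒮}, (0 : ℝ) < S.1.card := fun S =>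
    Nat.cast_pos.2 (Finset.card_pos.2 (hne S.1 S.2))
  refine ⟨fun S _ => (S.1.card : ℝ)⁻¹, fun S => S.1.card, fun S T i _ _ hle => ?_, fun S => ?_,
    fun S i => (inv_pos.2 (hpos S)).le⟩
  · exact inv_anti₀ (hpos S) hle
  · simp [(hpos S).ne']

end Feasible

/-! ### Laws with prescribed tails and their regularization -/

section Construction

open ProbabilityTheory

/-- A law with bounded density and prescribed tail probabilities at the naturals up to `N`. -/
theorem exists_measure_tail_eq (g : ℕ → ℝ) (hg : Antitone g) (N : ℕ) (h0 : g 0 = 1)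
    (hN : g N = 0) :
    ∃ μ : Measure ℝ, IsProbabilityMeasure μ ∧ μ ≪ volume ∧ Integrable (fun t : ℝ => t) μ ∧
      ∀ k ≤ N, μ.real (Set.Ioi (k : ℝ)) = g k := by
  have hnn : ∀ k, 0 ≤ g k - g (k + 1) := fun k => sub_nonneg.2 (hg k.le_succ)
  -- The mass `g k - g (k + 1)` is spread uniformly over `(k, k + 1]`; these masses telescope to
  -- one.
  let μ : Measure ℝ := ∑ k ∈ Finset.range N,
    ENNReal.ofReal (g k - g (k + 1)) • volume.restrict (Set.Ioc (k : ℝ) (k + 1))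
  have hreal : ∀ s, MeasurableSet s → μ s = ∑ k ∈ Finset.range N,
      ENNReal.ofReal (g k - g (k + 1)) * volume (s ∩ Set.Ioc (k : ℝ) (k + 1)) := by
    intro s hs
    simp only [μ, Measure.finsetSum_apply, Measure.smul_apply, smul_eq_mul,
      Measure.restrict_apply hs]
  have huniv : μ Set.univ = 1 := by
    rw [hreal _ MeasurableSet.univ]
    simp only [Set.univ_inter, Real.volume_Ioc, add_sub_cancel_left, ENNReal.ofReal_one, mul_one]
    rw [← ENNReal.ofReal_sum_of_nonneg fun k _ => hnn k, Finset.sum_range_sub', h0, hN]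
    simp
  refine ⟨μ, ⟨huniv⟩, ?_, ?_, fun j hj => ?_⟩
  · refine Measure.AbsolutelyContinuous.mk fun s hs h => ?_
    rw [hreal s hs]
    exact Finset.sum_eq_zero fun k _ =>
      mul_eq_zero_of_right _ (measure_mono_null Set.inter_subset_left h)
  · refine integrable_finsetSum_measure.2 fun k _ => Integrable.smul_measure ?_ (by simp)
    exact (continuous_id.integrableOn_Icc (a := (k : ℝ)) (b := k + 1)).mono_set
      Set.Ioc_subset_Icc_self
  · have hterm : ∀ k ∈ Finset.range N,
        ENNReal.ofReal (g k - g (k + 1)) * volume (Set.Ioi (j : ℝ) ∩ Set.Ioc (k : ℝ) (k + 1)) =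
          if j ≤ k then ENNReal.ofReal (g k - g (k + 1)) else 0 := by
      intro k _
      split_ifs with hjk
      · have : (j : ℝ) ≤ k := by exact_mod_cast hjk
        have hsub : Set.Ioc (k : ℝ) (k + 1) ⊆ Set.Ioi (j : ℝ) := fun t ht => this.trans_lt ht.1
        rw [Set.inter_eq_right.2 hsub]
        simp
      · have : (k : ℝ) + 1 ≤ j := by exact_mod_cast not_le.1 hjk
        have hdisj : Set.Ioi (j : ℝ) ∩ Set.Ioc (k : ℝ) (k + 1) = ∅ :=
          Set.eq_empty_of_forall_notMem fun t ht => absurd (ht.2.2.trans this) (not_le.2 ht.1)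
        rw [hdisj]
        simp
    rw [Measure.real, hreal _ measurableSet_Ioi, Finset.sum_congr rfl hterm,
      ← Finset.sum_filter]
    have hfil : (Finset.range N).filter (fun k => j ≤ k) = Finset.Ico j N := by
      ext k
      simp [and_comm]
    rw [hfil, ← ENNReal.ofReal_sum_of_nonneg fun k _ => hnn k,
      ENNReal.toReal_ofReal (Finset.sum_nonneg fun k _ => hnn k),
      Finset.sum_Ico_eq_sub _ hj, Finset.sum_range_sub', Finset.sum_range_sub', hN]
    ring

/-- Mixing with a small Gaussian component makes a law regular and hardly changes it. -/
theorem exists_regularMarginal_near {μ : Measure ℝ} [IsProbabilityMeasure μ] (hac : μ ≪ volume)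
    (hint : Integrable (fun t : ℝ => t) μ) {e : ℝ} (he : 0 < e) (he1 : e ≤ 1) :
    ∃ F : Measure ℝ, RegularMarginal F ∧ ∀ s, |F.real s - μ.real s| ≤ e := by
  let F : Measure ℝ := ENNReal.ofReal (1 - e) • μ + ENNReal.ofReal e • gaussianReal 0 1
  have hreal : ∀ s, F.real s = (1 - e) * μ.real s + e * (gaussianReal 0 1).real s := by
    intro s
    simp only [F, Measure.real, Measure.add_apply, Measure.smul_apply, smul_eq_mul]
    rw [ENNReal.toReal_add (by finiteness) (by finiteness), ENNReal.toReal_mul, ENNReal.toReal_mul,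
      ENNReal.toReal_ofReal (by linarith), ENNReal.toReal_ofReal he.le]
  have hprob : IsProbabilityMeasure F := by
    refine ⟨?_⟩
    simp only [F, Measure.add_apply, Measure.smul_apply, smul_eq_mul, measure_univ, mul_one]
    rw [← ENNReal.ofReal_add (by linarith) he.le]
    simp
  refine ⟨F, ⟨hprob, ?_, fun a _ b _ hab => ?_, ?_⟩, fun s => ?_⟩
  · exact Measure.AbsolutelyContinuous.add_left (hac.smul_left _)
      ((gaussianReal_absolutelyContinuous 0 one_ne_zero).smul_left _)
  · rw [cdf_eq_real, cdf_eq_real, hreal, hreal]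
    have h1 : μ.real (Set.Iic a) ≤ μ.real (Set.Iic b) :=
      measureReal_mono (Set.Iic_subset_Iic.2 hab.le)
    have h2 : (gaussianReal 0 1).real (Set.Iic a) < (gaussianReal 0 1).real (Set.Iic b) := by
      rw [← Set.Iic_union_Ioc_eq_Iic hab.le,
        measureReal_union (Set.Iic_disjoint_Ioc le_rfl) measurableSet_Ioc]
      have h3 : (gaussianReal 0 1) (Set.Ioc a b) ≠ 0 := fun h => by
        have := gaussianReal_absolutelyContinuous' 0 one_ne_zero h
        rw [Real.volume_Ioc, ENNReal.ofReal_eq_zero] at this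
        linarith
      have h4 : 0 < (gaussianReal 0 1).real (Set.Ioc a b) :=
        ENNReal.toReal_pos h3 (measure_ne_top _ _)
      linarith
    have h5 := mul_le_mul_of_nonneg_left h1 (sub_nonneg.2 he1)
    have h6 := mul_lt_mul_of_pos_left h2 he
    linarith
  · exact (hint.smul_measure (by simp)).add_measure
      (((memLp_id_gaussianReal' 1 (by simp)).integrable le_rfl).smul_measure (by simp))
  · have h1 : μ.real s ≤ 1 := measureReal_le_one
    have h2 : (gaussianReal 0 1).real s ≤ 1 := measureReal_le_one
    have h3 : 0 ≤ μ.real s := measureReal_nonneg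
    have h4 : 0 ≤ (gaussianReal 0 1).real s := measureReal_nonneg
    rw [hreal, abs_le]
    constructor <;> nlinarith

end Construction

/-! ### Antitone interpolation and stability of tails -/

section Density

variable {n : ℕ} {𝒮 : Finset (Finset (Fin n))}

/-- A feasible collection with positive integral levels below `N` interpolates, product by product,
to an antitone function on the naturals that falls from one to zero. -/
theorem Feasible.exists_antitone {x : Collection 𝒮} {r : {S // S ∈ 𝒮} → ℕ} {N : ℕ}
    (h : Feasible x fun S => (r S : ℝ)) (hr0 : ∀ S, 0 < r S) (hrN : ∀ S, r S < N) (hN : 0 < N)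
    (i : Fin n) :
    ∃ g : ℕ → ℝ, Antitone g ∧ g 0 = 1 ∧ g N = 0 ∧
      ∀ (S : {S // S ∈ 𝒮}) (hS : i ∈ S.1), g (r S) = x S ⟨i, hS⟩ := by
  classical
  let c : {S // S ∈ 𝒮} → NNReal := fun S => if hS : i ∈ S.1 then (x S ⟨i, hS⟩).toNNReal else 0
  -- The largest share of `i` among assortments of rank at least `k` is antitone, and by the order
  -- constraints it equals the share in `S` at `k = r S`. In `NNReal` the empty supremum is `0`, the
  -- value needed at `N`.
  let f : ℕ → NNReal := fun k => (Finset.univ.filter fun S => k ≤ r S).sup c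
  have hf : Antitone f := fun k l hkl => Finset.sup_mono fun S => by
    simp only [Finset.mem_filter_univ]
    exact hkl.trans
  have hf1 : ∀ k, f k ≤ 1 := fun k => Finset.sup_le fun S _ => by
    simp only [c]
    split_ifs with hS
    · rw [Real.toNNReal_le_one, ← h.sum_eq_one S]
      exact Finset.single_le_sum (fun j _ => h.nonneg S j) (Finset.mem_univ _)
    · exact zero_le_one
  refine ⟨fun k => if k = 0 then 1 else f k, fun k l hkl => ?_, by simp, ?_, fun S hS => ?_⟩
  · by_cases hk : k = 0
    · by_cases hl : l = 0
      · simp [hk, hl]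
      · simpa [hk, hl] using hf1 l
    · have hl : l ≠ 0 := by omega
      simpa [hk, hl] using hf hkl
  · have hempty : (Finset.univ.filter fun S => N ≤ r S) = ∅ :=
      Finset.filter_eq_empty_iff.2 fun S _ => not_le.2 (hrN S)
    simp only [hN.ne', if_false, f, hempty, Finset.sup_empty]
    rfl
  · have heq : f (r S) = c S := by
      refine le_antisymm (Finset.sup_le fun T hT => ?_)
        (Finset.le_sup (f := c) (Finset.mem_filter_univ S |>.2 le_rfl))
      rw [Finset.mem_filter_univ] at hT
      by_cases hiT : i ∈ T.1
      · simp only [c, hiT, hS, dif_pos]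
        exact Real.toNNReal_le_toNNReal (h.order S T i hS hiT (Nat.cast_le.2 hT))
      · simp [c, hiT]
    simp only [(hr0 S).ne', if_false, heq, c, hS, dif_pos]
    exact Real.coe_toNNReal _ (h.nonneg S _)

/-- If finitely many antitone functions change little in sum, each of them changes little. -/
theorem abs_sub_le_abs_sum_sub {ι : Type*} {s : Finset ι} {G : ι → ℝ → ℝ}
    (hG : ∀ i ∈ s, Antitone (G i)) (a b : ℝ) {i : ι} (hi : i ∈ s) :
    |G i a - G i b| ≤ |∑ j ∈ s, G j a - ∑ j ∈ s, G j b| := by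
  rw [← Finset.sum_sub_distrib]
  wlog hab : a ≤ b generalizing a b
  · have := this b a (le_of_not_ge hab)
    rw [abs_sub_comm, ← abs_neg (∑ j ∈ s, (G j a - G j b)), ← Finset.sum_neg_distrib]
    simpa only [neg_sub] using this
  have hnn : ∀ j ∈ s, 0 ≤ G j a - G j b := fun j hj => sub_nonneg.2 (hG j hj hab)
  rw [abs_of_nonneg (hnn i hi), abs_of_nonneg (Finset.sum_nonneg hnn)]
  exact Finset.single_le_sum hnn hi

end Density

/-! ### Closure of the representable set -/

section Closure

variable {n : ℕ} {𝒮 : Finset (Finset (Fin n))}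

theorem Feasible.mem_closure_representable (hne : ∀ S ∈ 𝒮, S.Nonempty) {x : Collection 𝒮}
    {lam : {S // S ∈ 𝒮} → ℝ} (hx : Feasible x lam) : x ∈ closure (representable 𝒮) := by
  classical
  obtain ⟨r, hr⟩ := hx.exists_rank
  -- The shift by one frees rank `0`, where the tail must be one; shifted ranks are at most `N - 1`.
  have hr' : Feasible x fun S => (((r S : ℕ) + 1 : ℕ) : ℝ) := by
    refine ⟨fun S T i hS hT hle => hr.order S T i hS hT ?_, hr.2, hr.3⟩
    push_cast at hle
    linarith
  let N := Fintype.card {S // S ∈ 𝒮} + 2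
  have hrN : ∀ S, (r S : ℕ) + 1 < N := fun S => Nat.succ_lt_succ (r S).2
  choose g hg hg0 hgN hgx using
    fun i => hr'.exists_antitone (fun S => Nat.succ_pos _) hrN (Nat.succ_pos _) i
  choose μ hμ hac hint hμg using
    fun i => exists_measure_tail_eq (g i) (hg i) N (hg0 i) (hgN i)
  refine Metric.mem_closure_iff.2 fun δ hδ => ?_
  -- Replacing `μ` by `F` costs `e` per tail, and moving the level costs at most `n * e`; together
  -- this is at most `δ / 2`.
  let e : ℝ := min 1 (δ / (2 * (n + 1)))
  have hn : (0 : ℝ) < 2 * (n + 1) := by positivity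
  have he : 0 < e := lt_min one_pos (div_pos hδ hn)
  have heδ : n * e + e < δ := by
    have h := (le_div_iff₀ hn).1 (min_le_right 1 (δ / (2 * (n + 1))))
    have : e * (2 * (n + 1)) ≤ δ := h
    nlinarith
  choose F hF hFμ using
    fun i => exists_regularMarginal_near (hac i) (hint i) he (min_le_left _ _)
  have hlev : ∀ S : {S // S ∈ 𝒮}, ∃ lam : ℝ, 1 < S.1.card →
      ∑ i ∈ S.1, (F i).real (Set.Ioi lam) = 1 := by
    intro S
    by_cases hS : 1 < S.1.card
    · obtain ⟨lam, h⟩ := exists_sum_tail_eq_one hF 0 hS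
      exact ⟨lam, fun _ => by simpa using h⟩
    · exact ⟨0, fun h => absurd h hS⟩
  choose lev hlev using hlev
  refine ⟨fun S i => if 1 < S.1.card then (F i).real (Set.Ioi (lev S)) else 1,
    mem_representable_of_tail hF 0 lev fun S => ?_, ?_⟩
  · by_cases hS : 1 < S.1.card
    · exact Or.inr ⟨hne S.1 S.2, by simpa using hlev S hS, fun i => by simp [hS]⟩
    · exact Or.inl ⟨le_antisymm (not_lt.1 hS) (Finset.card_pos.2 (hne S.1 S.2)),
        fun i => by simp [hS]⟩
  · refine (dist_pi_lt_iff hδ).2 fun S => (dist_pi_lt_iff hδ).2 fun i => ?_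
    rw [Real.dist_eq]
    by_cases hS : 1 < S.1.card
    · simp only [hS, if_true]
      have htail : ∀ j (hj : j ∈ S.1),
          (μ j).real (Set.Ioi (((r S : ℕ) + 1 : ℕ) : ℝ)) = x S ⟨j, hj⟩ := fun j hj =>
        (hμg j _ (hrN S).le).trans (hgx j S hj)
      have hsum : ∑ j ∈ S.1, (μ j).real (Set.Ioi (((r S : ℕ) + 1 : ℕ) : ℝ)) = 1 := by
        rw [← hx.sum_eq_one S, ← Finset.sum_coe_sort]
        exact Finset.sum_congr rfl fun j _ => htail j j.2
      -- The `μ`-tails sum to one at the rank, and to within `n * e` of one at `lev S`, where the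
      -- `F`-tails sum to one. So each single `μ`-tail moves by at most `n * e`.
      have h1 := abs_sub_le_abs_sum_sub (s := S.1) (G := fun j t => (μ j).real (Set.Ioi t))
        (fun j _ a b hab => measureReal_mono (Set.Ioi_subset_Ioi hab))
        (((r S : ℕ) + 1 : ℕ) : ℝ) (lev S) i.2
      rw [hsum, ← hlev S hS, ← Finset.sum_sub_distrib, htail i.1 i.2] at h1
      have h2 : |∑ j ∈ S.1, ((F j).real (Set.Ioi (lev S)) - (μ j).real (Set.Ioi (lev S)))|
          ≤ n * e := by
        refine (Finset.abs_sum_le_sum_abs _ _).trans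
          ((Finset.sum_le_card_nsmul _ _ e fun j _ => hFμ j _).trans ?_)
        rw [nsmul_eq_mul]
        refine mul_le_mul_of_nonneg_right ?_ he.le
        exact_mod_cast (Finset.card_le_univ S.1).trans_eq (Fintype.card_fin n)
      have h3 := hFμ i (Set.Ioi (lev S))
      rw [abs_sub_comm] at h3
      exact ((abs_sub_le _ _ _).trans (add_le_add (h1.trans h2) h3)).trans_lt heδ
    · have hcard : S.1.card = 1 :=
        le_antisymm (not_lt.1 hS) (Finset.card_pos.2 (hne S.1 S.2))
      have hsub : Subsingleton {i // i ∈ S.1} :=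
        Fintype.card_le_one_iff_subsingleton.1 (by simp [hcard])
      have h1 := hx.sum_eq_one S
      rw [Fintype.sum_subsingleton _ i] at h1
      simpa [hS, h1] using hδ

theorem closure_representable (hne : ∀ S ∈ 𝒮, S.Nonempty) :
    closure (representable 𝒮) = {x : Collection 𝒮 | ∃ lam, Feasible x lam} :=
  Set.Subset.antisymm
    (closure_minimal (fun _ hx => exists_feasible_of_mem_representable hne hx)
      isClosed_setOf_exists_feasible)
    fun _ ⟨_, h⟩ => h.mem_closure_representable hne

theorem continuousOn_totalLoss
    (loss : ∀ S : {S // S ∈ 𝒮}, ({i // i ∈ S.1} → ℝ) → ({i // i ∈ S.1} → ℝ) → ℝ≥0∞)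
    (p : Collection 𝒮)
    (hloss : ∀ S : {S // S ∈ 𝒮}, ContinuousOn (loss S (p S)) (stdSimplex ℝ {i // i ∈ S.1})) :
    ContinuousOn (totalLoss loss p) {x | ∃ lam, Feasible x lam} :=
  continuousOn_finsetSum _ fun S _ =>
    (hloss S).comp (continuous_apply S).continuousOn fun _ ⟨_, h⟩ => h.mem_stdSimplex S

end Closure

end MDM

theorem proposition4 {n : ℕ} (𝒮 : Finset (Finset (Fin n)))
    (loss : ∀ S : {S // S ∈ 𝒮}, ({i // i ∈ S.1} → ℝ) → ({i // i ∈ S.1} → ℝ) → ℝ≥0∞)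
    (p : MDM.Collection 𝒮)
    (hp : ∀ S : {S // S ∈ 𝒮}, p S ∈ stdSimplex ℝ {i // i ∈ S.1})
    (hloss : ∀ S : {S // S ∈ 𝒮}, ContinuousOn (loss S (p S)) (stdSimplex ℝ {i // i ∈ S.1})) :
    closure (MDM.representable 𝒮) =
        {x : MDM.Collection 𝒮 | ∃ lam : {S // S ∈ 𝒮} → ℝ, MDM.Feasible x lam} ∧
      IsLeast {v : ℝ≥0∞ | ∃ (x : MDM.Collection 𝒮) (lam : {S // S ∈ 𝒮} → ℝ),
        MDM.Feasible x lam ∧ v = MDM.totalLoss loss p x} (MDM.limitMDM loss p) := by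
  -- An empty assortment carries no probability vector, since the empty sum is not one.
  have hne : ∀ S ∈ 𝒮, S.Nonempty := fun S hS => by
    by_contra h
    rw [Finset.not_nonempty_iff_eq_empty] at h
    subst h
    simpa using (hp ⟨∅, hS⟩).2
  have hcl := MDM.closure_representable hne
  have hcont := MDM.continuousOn_totalLoss loss p hloss
  have hlower : ∀ x : MDM.Collection 𝒮, (∃ lam, MDM.Feasible x lam) →
      MDM.limitMDM loss p ≤ MDM.totalLoss loss p x := by
    intro x hx
    -- By continuity the loss at a point of the closure is a limit of losses at representable
    -- points.
    have hmem : MDM.totalLoss loss p x ∈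
        closure (MDM.totalLoss loss p '' MDM.representable 𝒮) :=
      ContinuousOn.image_closure (hcl ▸ hcont) ⟨x, hcl ▸ hx, rfl⟩
    refine closure_minimal ?_ isClosed_Ici hmem
    rintro _ ⟨y, hy, rfl⟩
    exact iInf₂_le (f := fun y (_ : y ∈ MDM.representable 𝒮) => MDM.totalLoss loss p y) y hy
  obtain ⟨x, ⟨lam, hx⟩, hmin⟩ :=
    MDM.isCompact_setOf_exists_feasible.exists_isMinOn (MDM.exists_feasible hne) hcont
  refine ⟨hcl, ⟨x, lam, hx, le_antisymm (hlower x ⟨lam, hx⟩) (le_iInf₂ fun y hy => ?_)⟩, ?_⟩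
  · exact hmin (MDM.exists_feasible_of_mem_representable hne hy)
  · rintro _ ⟨y, lam', hy, rfl⟩
    exact hlower y ⟨lam', hy⟩
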